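/- Let $1 \le r \le n$. For a loopfree matroid $M$ of rank $r$ on the labeled ground set $[n]=\{1,\dots,n\}$ let $v_M \in \mathbb{Z}^{\mathfrak{C}_{r,n}}$ be the vector whose coordinates are indexed by the set $\mathfrak{C}_{r,n}$ of all chains of sets $\emptyset = F_0 \subsetneq F_1 \subsetneq \dots \subsetneq F_r = [n]$, with $(v_M)_{\mathcal{C}} = 1$ if every set of the chain $\mathcal{C}$ is a flat of $M$, and $(v_M)_{\mathcal{C}} = 0$ otherwise. Let $\mathbb{M}_{r,n}$ be the quotient of the free $\mathbb{Z}$-module on the set of all loopfree matroids of rank $r$ on $[n]$ by the kernel of the homomorphism to $\mathbb{Z}^{\mathfrak{C}_{r,n}}$ given by $M \mapsto v_M$ (so $\mathbb{M}_{r,n}$ is isomorphic to the span of the vectors $v_M$). A matroid is called nested if its cyclic flats (the flats that are unions of circuits) form a chain under inclusion. Then the loopfree nested matroids of rank $r$ on $[n]$ (more precisely, the family of their classes) form a $\mathbb{Z}$-basis of $\mathbb{M}_{r,n}$. In particular, $\mathbb{M}_{r,n}$ is a free $\mathbb{Z}$-module, and the class of every loopfree matroid of rank $r$ on $[n]$ can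 be written in exactly one way as a $\mathbb{Z}$-linear combination of the classes of loopfree nested matroids of rank $r$ on $[n]$. -/

import Mathlib

namespace MatroidRing

/-- The cyclic part of a set `F` in a matroid `M`: the union of all circuits of `M` contained
in `F`. -/
def cyclicPart {α : Type*} (M : Matroid α) (F : Set α) : Set α :=
  ⋃₀ {C : Set α | M.IsCircuit C ∧ C ⊆ F}

/-- A cyclic flat is a flat which equals its cyclic part, i.e. which is a union of circuits. -/
def IsCyclicFlat {α : Type*} (M : Matroid α) (F : Set α) : Prop :=
  M.IsFlat F ∧ F = cyclicPart M F

/-- A matroid is nested if its cyclic flats form a chain under inclusion. -/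
def IsNested {α : Type*} (M : Matroid α) : Prop :=
  IsChain (· ⊆ ·) {F : Set α | IsCyclicFlat M F}

/-- The loopfree matroids of rank `r` on the labeled ground set `[n]`, modelled by `Fin n`. -/
def LoopfreeMatroid (r n : ℕ) : Type :=
  {M : Matroid (Fin n) // M.E = Set.univ ∧ M.Loopless ∧ M.eRank = (r : ℕ∞)}

/-- The chains `∅ = F₀ ⊊ F₁ ⊊ ⋯ ⊊ Fᵣ = [n]` of sets of length `r`. -/
def SetChain (r n : ℕ) : Type :=
  {F : Fin (r + 1) → Set (Fin n) //
    StrictMono F ∧ F 0 = ∅ ∧ F (Fin.last r) = Set.univ}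

open Classical in
/-- The vector `v_M`, in the `ℤ`-module with coordinates indexed by the chains of length `r`:
the coordinate of a chain is `1` if all its members are flats of `M`, and `0` otherwise. -/
noncomputable def indicatorVector {r n : ℕ} (M : LoopfreeMatroid r n) : SetChain r n → ℤ :=
  fun C => if ∀ i, M.1.IsFlat (C.1 i) then 1 else 0

/-- The homomorphism `Φ`, from the free `ℤ`-module on the loopfree matroids of rank `r` on `[n]`,
which sends the generator `M` to `v_M`. -/
noncomputable def Phi (r n : ℕ) : (LoopfreeMatroid r n →₀ ℤ) →ₗ[ℤ] (SetChain r n → ℤ) :=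
  Finsupp.linearCombination ℤ indicatorVector

/-- The rank `r` part of the intersection ring of matroids on `[n]`: the free `ℤ`-module on the
loopfree matroids of rank `r` on `[n]`, modulo the kernel of `Φ`. -/
abbrev MatroidModule (r n : ℕ) : Type :=
  (LoopfreeMatroid r n →₀ ℤ) ⧸ LinearMap.ker (Phi r n)

/-- The class of a loopfree matroid in the module `MatroidModule r n`. -/
noncomputable def matroidClass {r n : ℕ} (M : LoopfreeMatroid r n) : MatroidModule r n :=
  Submodule.Quotient.mk (Finsupp.single M 1)

/-- The loopfree nested matroids of rank `r` on `[n]`. -/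
def LoopfreeNestedMatroid (r n : ℕ) : Type :=
  {M : LoopfreeMatroid r n // IsNested M.1}

end MatroidRing

/-!
The vectors `v_M` are *balanced*: if all members of a chain are fixed except `Fᵢ₊₁`, then, the flats
covering a flat being a partition of the remaining elements, the number of flats `Fᵢ₊₁ ∋ a` that
complete the chain to a chain of flats does not depend on `a ∈ Fᵢ₊₂ \ Fᵢ`
(`indicatorVector_mem_balanced`).

A chain is *canonical* if every step `Fᵢ₊₁ \ Fᵢ` that consists of a single element lies below all
elements of the next step. A balanced function which vanishes on canonical chains vanishes
(`eq_zero_of_balanced`): give each chain the weight `∑ⱼ ∑_{x ∈ Fⱼ} (n - x)`. If a chain `C` is not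
canonical, with `Fᵢ₊₁ = Fᵢ ∪ {b}` and `a < b` in the next step, then the balancing condition for `a`
and `b` expresses the value at `C` by values at chains of larger weight.

A chain `C` defines a matroid `chainMatroid C`, with independent sets `I` given by `|I ∩ Fⱼ| ≤ j`.
It is loopfree and nested of rank `r`, and its cyclic flats are members of `C`. If `D` is a chain of
flats of it, then `|Dⱼ| ≤ |Cⱼ|` for all `j`, and if equality holds throughout and both chains are
canonical then `C = D` (`eq_or_chainSize_lt`). Hence the values of the vectors of these matroids on
the canonical chains form a unitriangular integral matrix, and as evaluation on canonical chains is
injective, the classes of the matroids `chainMatroid C` with `C` canonical are a basis of the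
matroid module.

These are exactly the loopfree nested matroids, each once (`canonicalEquiv`): a nested matroid has a
chain of flats through all its cyclic flats, one of maximal weight is canonical, and the matroid is
recovered from it because every circuit spans a cyclic flat.
-/

namespace MatroidRing

open Set

/-! ### Rank and cyclic flats in finite matroids -/

section Rank

variable {α : Type*} {M : Matroid α} {X Y I : Set α} {e : α}

/-- The rank of a set in a matroid on a finite type, as a natural number. -/
noncomputable def rk (M : Matroid α) (X : Set α) : ℕ := (M.eRk X).toNat

lemma coe_rk [Finite α] (M : Matroid α) (X : Set α) : (rk M X : ℕ∞) = M.eRk X :=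
  ENat.natCast_toNat (ne_top_of_le_ne_top (toFinite X).encard_lt_top.ne (M.eRk_le_encard X))

lemma rk_le_rk_iff [Finite α] {M' : Matroid α} : rk M X ≤ rk M' Y ↔ M.eRk X ≤ M'.eRk Y := by
  rw [← coe_rk, ← coe_rk, Nat.cast_le]

lemma rk_mono [Finite α] (M : Matroid α) (h : X ⊆ Y) : rk M X ≤ rk M Y :=
  rk_le_rk_iff.2 (M.eRk_mono h)

lemma rk_closure (M : Matroid α) (X : Set α) : rk M (M.closure X) = rk M X := by
  simp [rk]

lemma rk_indep (hI : M.Indep I) : rk M I = I.ncard := by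
  rw [rk, hI.eRk_eq_encard, ncard_def]

lemma ncard_le_rk [Finite α] (hI : M.Indep I) (h : I ⊆ X) : I.ncard ≤ rk M X :=
  rk_indep hI ▸ rk_mono M h

lemma rk_insert [Finite α] (he : e ∈ M.E) (heX : e ∉ M.closure X) :
    rk M (insert e X) = rk M X + 1 := by
  have := M.eRk_insert_eq_add_one (X := X) ⟨he, heX⟩
  rw [← coe_rk, ← coe_rk] at this
  exact_mod_cast this

lemma isBasis_of_rk_le [Finite α] (hI : M.Indep I) (hIX : I ⊆ X) (hX : X ⊆ M.E)
    (h : rk M X ≤ I.ncard) : M.IsBasis I X :=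
  hI.isBasis_of_eRk_ge (toFinite I) hIX (rk_le_rk_iff.1 (h.trans_eq (rk_indep hI).symm)) hX

lemma _root_.Matroid.IsFlat.eq_of_rk_le [Finite α] (hX : M.IsFlat X) (hY : Y ⊆ M.E) (hXY : X ⊆ Y)
    (h : rk M Y ≤ rk M X) : X = Y := by
  have hfin : M.IsRkFinite X := Matroid.eRk_ne_top_iff.1 (coe_rk M X ▸ ENat.natCast_ne_top _)
  have := hfin.closure_eq_closure_of_subset_of_eRk_ge_eRk hXY (rk_le_rk_iff.1 h)
  refine hXY.antisymm ?_
  rw [← hX.closure, this]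
  exact M.subset_closure Y hY

lemma _root_.Matroid.IsFlat.rk_lt_rk [Finite α] (hX : M.IsFlat X) (hY : Y ⊆ M.E) (hXY : X ⊂ Y) :
    rk M X < rk M Y := by
  by_contra! h
  exact hXY.ne (hX.eq_of_rk_le hY hXY.subset h)

lemma isCyclicFlat_closure {K : Set α} (hK : M.IsCircuit K) : IsCyclicFlat M (M.closure K) := by
  refine ⟨M.isFlat_closure _, Subset.antisymm (fun x hx ↦ ?_) (sUnion_subset fun C hC ↦ hC.2)⟩
  have hKc := M.subset_closure K hK.subset_ground
  by_cases hxK : x ∈ K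
  · exact ⟨K, ⟨hK, hKc⟩, hxK⟩
  · obtain ⟨C, hCx, hC, hxC⟩ := Matroid.exists_isCircuit_of_mem_closure hx hxK
    exact ⟨C, ⟨hC, hCx.trans (insert_subset hx hKc)⟩, hxC⟩

/-- A cyclic flat has no coloops. -/
lemma IsCyclicFlat.ne_insert {G : Set α} {b : α} {F : Set α} (hF : IsCyclicFlat M F)
    (hG : M.IsFlat G) (hb : b ∉ G) : F ≠ insert b G := by
  rintro rfl
  have hbF : b ∈ cyclicPart M (insert b G) := hF.2 ▸ mem_insert b G
  obtain ⟨K, ⟨hK, hKG⟩, hbK⟩ := hbF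
  refine hb (hG.closure ▸ M.closure_subset_closure ?_ (hK.mem_closure_sdiff_singleton_of_mem hbK))
  rintro x ⟨hx, hxb⟩
  exact (hKG hx).resolve_left hxb

end Rank

variable {r n : ℕ}

/-! ### Chains of sets -/

namespace SetChain

/-- The member `Fᵢ` of a chain `F₀ ⊊ ⋯ ⊊ Fᵣ`, where `i` is any natural number; the chain is
continued by `Fᵢ = [n]` for `i ≥ r`. -/
def nth (C : SetChain r n) (i : ℕ) : Set (Fin n) := C.1 ⟨min i r, by omega⟩

variable (C D : SetChain r n) {i j : ℕ}

lemma nth_zero : C.nth 0 = ∅ := by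
  have := C.2.2.1
  simpa [nth] using this

lemma nth_of_le (h : r ≤ i) : C.nth i = univ := by
  have := C.2.2.2
  simpa [nth, min_eq_right h, Fin.last] using this

lemma nth_min : C.nth (min i r) = C.nth i := by
  simp [nth]

lemma nth_mono : Monotone C.nth := fun _ _ h ↦
  C.2.1.monotone (Fin.mk_le_mk.2 (min_le_min_right r h))

lemma nth_ssubset (h : i < j) (hj : j ≤ r) : C.nth i ⊂ C.nth j :=
  C.2.1 (Fin.mk_lt_mk.2 (by omega))

variable {C D} in
lemma ext_nth (h : ∀ i ≤ r, C.nth i = D.nth i) : C = D := by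
  refine Subtype.ext (funext fun i ↦ ?_)
  have := h i.1 (by omega)
  simpa [nth, min_eq_left (show i.1 ≤ r by omega)] using this

lemma exists_of_nat (f : ℕ → Set (Fin n)) (h0 : f 0 = ∅) (hr : f r = univ)
    (h : ∀ i < r, f i ⊂ f (i + 1)) : ∃ C : SetChain r n, ∀ i ≤ r, C.nth i = f i := by
  refine ⟨⟨fun i ↦ f i, ?_, by simpa using h0, by simpa using hr⟩, fun i hi ↦ ?_⟩
  · exact Fin.strictMono_iff_lt_succ.2 fun i ↦ by simpa using! h i i.2
  · simp [nth, min_eq_left hi]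

/-- Two chains agree except possibly in their member with index `k`. -/
def AgreeOff (C D : SetChain r n) (k : ℕ) : Prop := ∀ j, j ≠ k → D.nth j = C.nth j

lemma exists_replace (hi : i + 2 ≤ r) {S : Set (Fin n)} (h1 : C.nth i ⊂ S)
    (h2 : S ⊂ C.nth (i + 2)) :
    ∃ D : SetChain r n, D.nth (i + 1) = S ∧ AgreeOff C D (i + 1) := by
  obtain ⟨D, hD⟩ := exists_of_nat (r := r) (Function.update C.nth (i + 1) S)
    (by rw [Function.update_of_ne (by omega), C.nth_zero])
    (by rw [Function.update_of_ne (by omega), C.nth_of_le le_rfl]) (fun j hj ↦ by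
      rcases eq_or_ne j i with rfl | hji
      · simpa [Function.update_of_ne] using h1
      rcases eq_or_ne j (i + 1) with rfl | hji'
      · simpa [Function.update_of_ne] using h2
      rw [Function.update_of_ne hji', Function.update_of_ne (by omega)]
      exact C.nth_ssubset (by omega) hj)
  refine ⟨D, by rw [hD _ (by omega), Function.update_self], fun j hj ↦ ?_⟩
  rcases le_total j r with hjr | hjr
  · rw [hD _ hjr, Function.update_of_ne hj]
  · rw [nth_of_le _ hjr, nth_of_le _ hjr]

lemma ncard_nth_lt (h : i < j) (hj : j ≤ r) : (C.nth i).ncard < (C.nth j).ncard :=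
  ncard_lt_ncard (C.nth_ssubset h hj)

lemma ncard_nth_add_le (h : i ≤ j) (hj : j ≤ r) :
    (C.nth i).ncard + (j - i) ≤ (C.nth j).ncard := by
  induction j, h using Nat.le_induction with
  | base => simp
  | succ j h ih =>
    have := ih (by omega)
    have := C.ncard_nth_lt (lt_add_one j) hj
    omega

lemma exists_eq_insert (hi : i + 1 ≤ r) (h : ¬ (C.nth i).ncard + 2 ≤ (C.nth (i + 1)).ncard) :
    ∃ b ∉ C.nth i, C.nth (i + 1) = insert b (C.nth i) := by
  have h1 := C.ncard_nth_lt (lt_add_one i) hi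
  obtain ⟨b, hb, hbi⟩ := exists_of_ssubset (C.nth_ssubset (lt_add_one i) hi)
  refine ⟨b, hbi, (eq_of_subset_of_ncard_le
    (insert_subset hb (C.nth_mono (Nat.le_succ i))) ?_).symm⟩
  rw [ncard_insert_of_notMem hbi]
  omega

end SetChain

open SetChain

/-! ### Chains of flats -/

/-- All members of the chain `C` are flats of `M`. -/
def IsFlatChain (M : Matroid (Fin n)) (C : SetChain r n) : Prop := ∀ i, M.IsFlat (C.nth i)

lemma isFlatChain_iff {M : Matroid (Fin n)} {C : SetChain r n} :
    IsFlatChain M C ↔ ∀ i, M.IsFlat (C.1 i) := by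
  refine ⟨fun h i ↦ ?_, fun h i ↦ h _⟩
  have := h i.1
  simpa [nth, min_eq_left (show i.1 ≤ r by omega)] using this

namespace LoopfreeMatroid

lemma subset_ground (M : LoopfreeMatroid r n) (X : Set (Fin n)) : X ⊆ M.1.E :=
  (subset_univ X).trans_eq M.2.1.symm

lemma rk_univ (M : LoopfreeMatroid r n) : rk M.1 univ = r := by
  have h := coe_rk M.1 univ
  rw [Matroid.eRk_univ_eq, M.2.2.2] at h
  exact_mod_cast h

lemma isFlat_univ (M : LoopfreeMatroid r n) : M.1.IsFlat univ := by
  have := M.1.ground_isFlat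
  rwa [M.2.1] at this

lemma isFlat_empty (M : LoopfreeMatroid r n) : M.1.IsFlat ∅ := by
  have := M.2.2.1
  rw [← M.1.loops_eq_empty]
  exact M.1.isFlat_closure _

lemma rk_add_le {M : LoopfreeMatroid r n} {C : SetChain r n} (h : IsFlatChain M.1 C) {i j : ℕ}
    (hij : i ≤ j) (hj : j ≤ r) : rk M.1 (C.nth i) + (j - i) ≤ rk M.1 (C.nth j) := by
  induction j, hij using Nat.le_induction with
  | base => simp
  | succ j hij ih =>
    have h1 := ih (by omega)
    have h2 := (h j).rk_lt_rk (M.subset_ground _) (C.nth_ssubset (lt_add_one j) hj)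
    omega

/-- In a chain of `r + 1` flats of a matroid of rank `r`, the ranks are `0, 1, …, r`. -/
lemma rk_nth {M : LoopfreeMatroid r n} {C : SetChain r n} (h : IsFlatChain M.1 C) {i : ℕ}
    (hi : i ≤ r) : rk M.1 (C.nth i) = i := by
  have h1 := rk_add_le h (Nat.zero_le i) hi
  have h2 := rk_add_le h hi le_rfl
  rw [C.nth_of_le le_rfl, M.rk_univ] at h2
  omega

/-- The flats covering a flat `F` partition the complement of `F`: among the chains of flats that
differ from a given one only in the member with index `i + 1`, exactly one has the element `a` in
that member. -/
lemma existsUnique_agreeOff {M : LoopfreeMatroid r n} {C : SetChain r n} (h : IsFlatChain M.1 C)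
    {i : ℕ} (hi : i + 2 ≤ r) {a : Fin n} (ha : a ∈ C.nth (i + 2)) (ha' : a ∉ C.nth i) :
    ∃! D : SetChain r n, (AgreeOff C D (i + 1) ∧ a ∈ D.nth (i + 1)) ∧ IsFlatChain M.1 D := by
  set S := M.1.closure (insert a (C.nth i)) with hS
  have hsub : insert a (C.nth i) ⊆ S := M.1.subset_closure _ (M.subset_ground _)
  have hrk : rk M.1 S = i + 1 := by
    rw [hS, rk_closure, rk_insert (M.subset_ground univ trivial) (by rwa [(h i).closure]),
      rk_nth h (by omega)]
  have hS2 : S ⊆ C.nth (i + 2) := by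
    rw [← (h (i + 2)).closure]
    exact M.1.closure_subset_closure (insert_subset ha (C.nth_mono (by omega)))
  have h1 : C.nth i ⊂ S :=
    ssubset_of_subset_of_ne ((subset_insert a _).trans hsub)
      (fun he ↦ ha' (he ▸ hsub (mem_insert a _)))
  have h2 : S ⊂ C.nth (i + 2) := by
    refine ssubset_of_subset_of_ne hS2 fun he ↦ ?_
    have := rk_nth h hi
    rw [← he, hrk] at this
    omega
  obtain ⟨D, hDS, hD⟩ := C.exists_replace hi h1 h2
  refine ⟨D, ⟨⟨hD, hDS ▸ hsub (mem_insert a _)⟩, fun j ↦ ?_⟩, ?_⟩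
  · rcases eq_or_ne j (i + 1) with rfl | hj
    · exact hDS ▸ M.1.isFlat_closure _
    · exact hD j hj ▸ h j
  · rintro D' ⟨⟨hD', haD'⟩, hfl⟩
    refine ext_nth fun j hj ↦ ?_
    rcases eq_or_ne j (i + 1) with rfl | hj
    · rw [hDS]
      refine ((M.1.isFlat_closure _).eq_of_rk_le (M.subset_ground _) ?_ ?_).symm
      · rw [← (hfl (i + 1)).closure]
        refine M.1.closure_subset_closure (insert_subset haD' ?_)
        rw [← hD' i (by omega)]
        exact D'.nth_mono (by omega)
      · rw [← hS, hrk, rk_nth hfl (by omega)]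
    · rw [hD' j hj, hD j hj]

end LoopfreeMatroid

/-! ### Balanced functions on chains -/

noncomputable instance : Fintype (SetChain r n) :=
  have : Finite (SetChain r n) := inferInstanceAs (Finite (Subtype _))
  Fintype.ofFinite _

open Classical in
/-- The balanced functions on chains: the sum over all chains differing from `C` only in the member
`Fᵢ₊₁`, and with `a ∈ Fᵢ₊₁`, is the same for all elements `a` of `Fᵢ₊₂ \ Fᵢ`. -/
def balanced (r n : ℕ) : Submodule ℤ (SetChain r n → ℤ) where
  carrier := {w | ∀ (C : SetChain r n) (i : ℕ), i + 2 ≤ r → ∀ a b,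
    a ∈ C.nth (i + 2) → a ∉ C.nth i → b ∈ C.nth (i + 2) → b ∉ C.nth i →
    ∑ D with AgreeOff C D (i + 1) ∧ a ∈ D.nth (i + 1), w D =
      ∑ D with AgreeOff C D (i + 1) ∧ b ∈ D.nth (i + 1), w D}
  add_mem' := fun hv hw C i hi a b ha ha' hb hb' ↦ by
    simp only [Pi.add_apply, Finset.sum_add_distrib, hv C i hi a b ha ha' hb hb',
      hw C i hi a b ha ha' hb hb']
  zero_mem' := by simp
  smul_mem' := fun c w hw C i hi a b ha ha' hb hb' ↦ by
    simp only [Pi.smul_apply, ← Finset.smul_sum, hw C i hi a b ha ha' hb hb']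

open Classical in
lemma indicatorVector_apply (M : LoopfreeMatroid r n) (C : SetChain r n) :
    indicatorVector M C = if IsFlatChain M.1 C then 1 else 0 := by
  simp only [indicatorVector, isFlatChain_iff]

lemma indicatorVector_mem_balanced (M : LoopfreeMatroid r n) :
    indicatorVector M ∈ balanced r n := by
  classical
  intro C i hi a b ha ha' hb hb'
  by_cases h : ∃ C', AgreeOff C C' (i + 1) ∧ IsFlatChain M.1 C'
  · obtain ⟨C', hC', hfl⟩ := h
    have key : ∀ a, a ∈ C.nth (i + 2) → a ∉ C.nth i →
        ∑ D with AgreeOff C D (i + 1) ∧ a ∈ D.nth (i + 1), indicatorVector M D = 1 := by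
      intro a ha ha'
      obtain ⟨D, ⟨hD, hDfl⟩, hD'⟩ := M.existsUnique_agreeOff hfl hi (a := a)
        (by rwa [hC' _ (by omega)]) (by rwa [hC' _ (by omega)])
      have hiff : ∀ E, AgreeOff C' E (i + 1) ↔ AgreeOff C E (i + 1) := fun E ↦
        forall₂_congr fun j hj ↦ by rw [hC' j hj]
      simp only [hiff] at hD hD'
      rw [Finset.sum_eq_single_of_mem D (by simpa using hD), indicatorVector_apply, if_pos hDfl]
      intro E hE hne
      rw [indicatorVector_apply, if_neg]
      exact fun hEfl ↦ hne (hD' E ⟨by simpa using hE, hEfl⟩)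
    rw [key a ha ha', key b hb hb']
  · push Not at h
    rw [Finset.sum_eq_zero, Finset.sum_eq_zero]
    all_goals
      intro D hD
      rw [indicatorVector_apply, if_neg (h D (Finset.mem_filter.1 hD).2.1)]

/-- The weight of a set: an element `x` contributes `n - x`, so that smaller elements weigh more
and all weights are positive. -/
noncomputable def setWeight (S : Set (Fin n)) : ℕ := ∑ x ∈ (toFinite S).toFinset, (n - x.1)

/-- The weight of a chain is the sum of the weights of its members. -/
noncomputable def chainWeight (C : SetChain r n) : ℕ :=
  ∑ j ∈ Finset.range (r + 1), setWeight (C.nth j)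

lemma setWeight_insert {S : Set (Fin n)} {x : Fin n} (h : x ∉ S) :
    setWeight (insert x S) = (n - x.1) + setWeight S := by
  classical
  rw [setWeight, Finite.toFinset_insert', Finset.sum_insert (by simpa using h)]
  rfl

lemma setWeight_mono {S T : Set (Fin n)} (h : S ⊆ T) : setWeight S ≤ setWeight T :=
  Finset.sum_le_sum_of_subset (by simpa using h)

lemma setWeight_lt {S T : Set (Fin n)} (h : S ⊂ T) : setWeight S < setWeight T := by
  obtain ⟨x, hx, hxS⟩ := exists_of_ssubset h
  have h1 := setWeight_insert hxS
  have h2 := setWeight_mono (insert_subset hx h.subset)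
  have := x.2
  omega

lemma chainWeight_lt {C D : SetChain r n} {i : ℕ} (hi : i + 2 ≤ r) (h : AgreeOff C D (i + 1))
    {a b : Fin n} (hb : C.nth (i + 1) = insert b (C.nth i)) (ha : a ∉ C.nth (i + 1))
    (hab : a < b) (hne : D ≠ C) (hD : a ∈ D.nth (i + 1) ∨ b ∈ D.nth (i + 1)) :
    chainWeight C < chainWeight D := by
  have hbi : b ∉ C.nth i := fun hbi ↦ by
    rw [insert_eq_of_mem hbi] at hb
    exact (C.nth_ssubset (lt_add_one i) (by omega)).ne hb.symm
  have hai : a ∉ C.nth i := fun h ↦ ha (C.nth_mono (Nat.le_succ i) h)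
  have hsub : C.nth i ⊆ D.nth (i + 1) := h i (by omega) ▸ D.nth_mono (Nat.le_succ i)
  have hne' : D.nth (i + 1) ≠ C.nth (i + 1) := fun he ↦ hne <| ext_nth fun j _ ↦ by
    rcases eq_or_ne j (i + 1) with rfl | hj
    exacts [he, h j hj]
  refine Finset.sum_lt_sum (fun j _ ↦ ?_) ⟨i + 1, by simp; omega, ?_⟩
  · rcases eq_or_ne j (i + 1) with rfl | hj
    · rcases hD with hD | hD
      · have h1 := setWeight_insert hbi
        have h2 := setWeight_insert hai
        have h3 := setWeight_mono (insert_subset hD hsub)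
        rw [hb]
        have : a.1 < b.1 := hab
        omega
      · rw [hb]
        exact setWeight_mono (insert_subset hD hsub)
    · rw [h j hj]
  · rcases hD with hD | hD
    · have h1 := setWeight_insert hbi
      have h2 := setWeight_insert hai
      have h3 := setWeight_mono (insert_subset hD hsub)
      rw [hb]
      have : a.1 < b.1 := hab
      have := b.2
      omega
    · refine setWeight_lt (ssubset_of_subset_of_ne ?_ hne'.symm)
      rw [hb]
      exact insert_subset hD hsub

/-- A chain is canonical if, whenever a step `Fᵢ₊₁ \ Fᵢ` consists of a single element, this element
is smaller than all elements of the following step. -/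
def IsCanonical (C : SetChain r n) : Prop :=
  ∀ i, i + 2 ≤ r → ∀ b, C.nth (i + 1) = insert b (C.nth i) →
    ∀ a ∈ C.nth (i + 2), a ∉ C.nth (i + 1) → b < a

lemma exists_of_not_isCanonical {C : SetChain r n} (h : ¬ IsCanonical C) :
    ∃ i, i + 2 ≤ r ∧ ∃ a b, C.nth (i + 1) = insert b (C.nth i) ∧ a ∈ C.nth (i + 2) ∧
      a ∉ C.nth (i + 1) ∧ a < b := by
  simp only [IsCanonical, not_forall, not_lt] at h
  obtain ⟨i, hi, b, hb, a, ha, ha', hab⟩ := h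
  refine ⟨i, hi, a, b, hb, ha, ha', lt_of_le_of_ne hab ?_⟩
  rintro rfl
  exact ha' (hb ▸ mem_insert a _)

/-- In the support of a balanced function, a chain of maximal weight is canonical: at a place where
it is not, all other terms of the balancing condition have larger weight. -/
lemma eq_zero_of_balanced {w : SetChain r n → ℤ} (hw : w ∈ balanced r n)
    (h0 : ∀ C, IsCanonical C → w C = 0) : w = 0 := by
  classical
  by_contra hne
  obtain ⟨C₀, hC₀⟩ := Function.ne_iff.1 hne
  obtain ⟨C, hC, hmax⟩ := Finset.exists_max_image {C | w C ≠ 0} chainWeight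
    ⟨C₀, by simpa using hC₀⟩
  simp only [Finset.mem_filter, Finset.mem_univ, true_and] at hC hmax
  obtain ⟨i, hi, a, b, hb, ha, ha', hab⟩ := exists_of_not_isCanonical fun h ↦ hC (h0 C h)
  have hzero : ∀ D, AgreeOff C D (i + 1) → D ≠ C → (a ∈ D.nth (i + 1) ∨ b ∈ D.nth (i + 1)) →
      w D = 0 := fun D hD hne hmem ↦ by
    by_contra hwD
    exact (hmax D hwD).not_gt (chainWeight_lt hi hD hb ha' hab hne hmem)
  have hb1 : b ∈ C.nth (i + 1) := hb ▸ mem_insert b _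
  have hbi : b ∉ C.nth i := fun hbi ↦ by
    rw [insert_eq_of_mem hbi] at hb
    exact (C.nth_ssubset (lt_add_one i) (by omega)).ne hb.symm
  have hbal := hw C i hi a b ha (fun h ↦ ha' (C.nth_mono (Nat.le_succ i) h))
    (C.nth_mono (Nat.le_succ _) hb1) hbi
  rw [Finset.sum_eq_zero, Finset.sum_eq_single_of_mem C] at hbal
  · exact hC hbal.symm
  · exact Finset.mem_filter.2 ⟨Finset.mem_univ C, fun _ _ ↦ rfl, hb1⟩
  · intro D hD hne
    simp only [Finset.mem_filter, Finset.mem_univ, true_and] at hD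
    exact hzero D hD.1 hne (Or.inr hD.2)
  · intro D hD
    simp only [Finset.mem_filter, Finset.mem_univ, true_and] at hD
    exact hzero D hD.1 (fun h ↦ ha' (h ▸ hD.2)) (Or.inl hD.2)

/-! ### The nested matroid of a chain -/

/-- A set `I` is independent for the chain `C` if `|I ∩ Fⱼ| ≤ j` for every member `Fⱼ`. -/
def ChainIndep (C : SetChain r n) (I : Set (Fin n)) : Prop := ∀ j, (I ∩ C.nth j).ncard ≤ j

namespace ChainIndep

variable {C : SetChain r n} {I J : Set (Fin n)} {i j k : ℕ} {e : Fin n}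

lemma empty (C : SetChain r n) : ChainIndep C ∅ := by simp [ChainIndep]

lemma mono (hJ : ChainIndep C J) (h : I ⊆ J) : ChainIndep C I := fun j ↦
  (ncard_le_ncard (inter_subset_inter_left _ h)).trans (hJ j)

lemma ncard_le (hI : ChainIndep C I) : I.ncard ≤ r := by
  simpa [C.nth_of_le le_rfl] using hI r

lemma ncard_le_of_subset (hI : ChainIndep C I) (h : I ⊆ C.nth j) : I.ncard ≤ j := by
  simpa [inter_eq_left.2 h] using hI j

/-- There is a largest member of the chain which is tight for `I`. -/
lemma exists_tight (hI : ChainIndep C I) :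
    ∃ k ≤ r, (I ∩ C.nth k).ncard = k ∧ ∀ j, k < j → (I ∩ C.nth j).ncard < j := by
  classical
  let P : ℕ → Prop := fun k ↦ (I ∩ C.nth k).ncard = k
  have h0 : P 0 := by simp [P, C.nth_zero]
  refine ⟨Nat.findGreatest P r, Nat.findGreatest_le r,
    Nat.findGreatest_spec (P := P) (Nat.zero_le r) h0, fun j hj ↦ ?_⟩
  rcases le_or_gt j r with hjr | hjr
  · exact lt_of_le_of_ne (hI j) (Nat.findGreatest_is_greatest (P := P) hj hjr)
  · exact ((ncard_le_ncard inter_subset_left).trans hI.ncard_le).trans_lt hjr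

lemma insert (hI : ChainIndep C I) (hk : ∀ j, k < j → (I ∩ C.nth j).ncard < j)
    (he : e ∉ C.nth k) : ChainIndep C (insert e I) := fun j ↦ by
  rcases le_or_gt j k with hj | hj
  · rw [insert_inter_of_notMem fun h ↦ he (C.nth_mono hj h)]
    exact hI j
  · refine (ncard_le_ncard (t := Insert.insert e (I ∩ C.nth j)) ?_).trans
      ((ncard_insert_le _ _).trans (hk j hj))
    rintro x ⟨rfl | hx, hxj⟩
    exacts [mem_insert _ _, mem_insert_of_mem _ ⟨hx, hxj⟩]

/-- The augmentation axiom: any element of `J` outside of the largest tight member of the chain can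
be added to `I`. -/
lemma exists_insert (hI : ChainIndep C I) (hJ : ChainIndep C J) (h : I.ncard < J.ncard) :
    ∃ e ∈ J, e ∉ I ∧ ChainIndep C (Insert.insert e I) := by
  obtain ⟨k, -, hk, hk'⟩ := hI.exists_tight
  have h1 := ncard_inter_add_ncard_sdiff_eq_ncard I (C.nth k)
  have h2 := ncard_inter_add_ncard_sdiff_eq_ncard J (C.nth k)
  have h3 := hJ k
  obtain ⟨e, he, heI⟩ := exists_mem_notMem_of_ncard_lt_ncard
    (show (I \ C.nth k).ncard < (J \ C.nth k).ncard by omega)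
  exact ⟨e, he.1, fun h ↦ heI ⟨h, he.2⟩, hI.insert hk' he.2⟩

lemma exists_subset_nth (C : SetChain r n) (hi : i ≤ r) :
    ∃ I ⊆ C.nth i, ChainIndep C I ∧ I.ncard = i := by
  induction i with
  | zero => exact ⟨∅, empty_subset _, empty C, by simp⟩
  | succ i ih =>
    obtain ⟨I, hIi, hI, hcard⟩ := ih (by omega)
    obtain ⟨e, he, hei⟩ := exists_of_ssubset (C.nth_ssubset (lt_add_one i) hi)
    refine ⟨Insert.insert e I, insert_subset he (hIi.trans (C.nth_mono (Nat.le_succ i))),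
      hI.insert (fun j hj ↦ ?_) hei, ?_⟩
    · exact (ncard_le_ncard inter_subset_left).trans_lt (hcard.trans_lt hj)
    · rw [ncard_insert_of_notMem fun h ↦ hei (hIi h), hcard]

end ChainIndep

/-- The matroid on `[n]` whose independent sets `I` are given by `|I ∩ Fⱼ| ≤ j` for the members `Fⱼ`
of the chain `C`. It is the freest matroid of rank `r` in which these members are flats. -/
def chainMatroid (C : SetChain r n) : Matroid (Fin n) :=
  (IndepMatroid.ofFinite finite_univ (ChainIndep C) (ChainIndep.empty C)
    (fun _ _ hJ h ↦ hJ.mono h) (fun _ _ hI hJ h ↦ hI.exists_insert hJ h)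
    (fun _ _ ↦ subset_univ _)).matroid

section chainMatroid

variable {C D : SetChain r n} {i j k : ℕ}

lemma chainMatroid_indep {I : Set (Fin n)} : (chainMatroid C).Indep I ↔ ChainIndep C I := Iff.rfl

lemma rk_chainMatroid_le (C : SetChain r n) (i : ℕ) : rk (chainMatroid C) (C.nth i) ≤ i := by
  obtain ⟨I, hI⟩ := (chainMatroid C).exists_isBasis (C.nth i) (subset_univ _)
  rw [rk, hI.eRk_eq_encard, ← ncard_def]
  exact ChainIndep.ncard_le_of_subset hI.indep hI.subset

/-- An independent subset of `Fᵢ` with `i` elements spans `Fᵢ`. -/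
lemma chainMatroid_isBasis {I : Set (Fin n)} (hI : ChainIndep C I) (hIi : I ⊆ C.nth i)
    (h : i ≤ I.ncard) : (chainMatroid C).IsBasis I (C.nth i) :=
  isBasis_of_rk_le hI hIi (subset_univ _) ((rk_chainMatroid_le C i).trans h)

lemma isFlatChain_chainMatroid (C : SetChain r n) : IsFlatChain (chainMatroid C) C := fun i ↦ by
  rw [← C.nth_min]
  set i' := min i r with hi'
  obtain ⟨I, hIi, hI, hcard⟩ := ChainIndep.exists_subset_nth C (show i' ≤ r by omega)
  rw [Matroid.isFlat_iff_closure_eq, ← (chainMatroid_isBasis hI hIi hcard.ge).closure_eq_closure]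
  refine Subset.antisymm (fun e he ↦ ?_) (chainMatroid_isBasis hI hIi hcard.ge).subset_closure
  by_contra hei
  have hins : ChainIndep C (insert e I) := hI.insert (fun j hj ↦
    (ncard_le_ncard inter_subset_left).trans_lt (hcard.trans_lt hj)) hei
  exact (((chainMatroid_indep.2 hI).mem_closure_iff_of_notMem fun h ↦ hei (hIi h)).1 he).not_indep
    hins

lemma chainMatroid_loopless (C : SetChain r n) : (chainMatroid C).Loopless := by
  rw [Matroid.loopless_iff_forall_isNonloop]
  intro e _
  rw [← Matroid.indep_singleton, chainMatroid_indep]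
  intro j
  rcases Nat.eq_zero_or_pos j with rfl | hj
  · simp [C.nth_zero]
  · exact (ncard_le_ncard inter_subset_left).trans (by rw [ncard_singleton]; exact hj)

lemma chainMatroid_eRank (C : SetChain r n) : (chainMatroid C).eRank = (r : ℕ∞) := by
  obtain ⟨I, hIi, hI, hcard⟩ := ChainIndep.exists_subset_nth C le_rfl
  have := chainMatroid_isBasis hI hIi hcard.ge
  rw [C.nth_of_le le_rfl] at this
  rw [← Matroid.eRk_univ_eq, this.eRk_eq_encard, ← (toFinite I).cast_ncard_eq, hcard]

/-- A circuit of the matroid of `C` spans a member of `C`, since it meets some `Fⱼ` in at least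
`j + 1` elements. -/
lemma exists_closure_eq_nth_of_isCircuit {K : Set (Fin n)} (hK : (chainMatroid C).IsCircuit K) :
    ∃ j, (chainMatroid C).closure K = C.nth j := by
  have hdep : ¬ ChainIndep C K := hK.not_indep
  simp only [ChainIndep, not_forall, not_le] at hdep
  obtain ⟨j, hj⟩ := hdep
  have hKj : K ∩ C.nth j = K := hK.eq_of_not_indep_subset
    (fun h ↦ hj.not_ge (ChainIndep.ncard_le_of_subset h inter_subset_right)) inter_subset_left
  have hsub : K ⊆ C.nth j := inter_eq_left.1 hKj
  rw [hKj] at hj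
  obtain ⟨x, hx⟩ := hK.nonempty
  have hbas : (chainMatroid C).IsBasis (K \ {x}) (C.nth j) :=
    chainMatroid_isBasis (hK.sdiff_singleton_indep hx) (sdiff_subset.trans hsub) (by
      rw [ncard_sdiff_singleton_of_mem hx]; omega)
  refine ⟨j, ?_⟩
  rw [← hK.closure_sdiff_singleton_eq x, hbas.closure_eq_closure,
    (isFlatChain_chainMatroid C j).closure]

lemma exists_eq_nth_of_isCyclicFlat {Z : Set (Fin n)} (hZ : IsCyclicFlat (chainMatroid C) Z) :
    ∃ k, Z = C.nth k := by
  classical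
  let k := Nat.findGreatest (fun k ↦ C.nth k ⊆ Z) r
  refine ⟨k, Subset.antisymm (fun x hx ↦ ?_) ?_⟩
  · rw [hZ.2] at hx
    obtain ⟨K, ⟨hK, hKZ⟩, hxK⟩ := hx
    obtain ⟨j, hj⟩ := exists_closure_eq_nth_of_isCircuit hK
    have hjZ : C.nth (min j r) ⊆ Z := by
      rw [C.nth_min, ← hj, ← hZ.1.closure]
      exact (chainMatroid C).closure_subset_closure hKZ
    refine C.nth_mono (Nat.le_findGreatest (min_le_right j r) hjZ) ?_
    rw [C.nth_min, ← hj]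
    exact (chainMatroid C).subset_closure K hK.subset_ground hxK
  · exact Nat.findGreatest_spec (P := fun k ↦ C.nth k ⊆ Z) (Nat.zero_le r)
      (by simp [C.nth_zero])

/-- The matroid of a chain, as a loopfree nested matroid of rank `r`. -/
def chainNested (C : SetChain r n) : LoopfreeNestedMatroid r n :=
  ⟨⟨chainMatroid C, rfl, chainMatroid_loopless C, chainMatroid_eRank C⟩, fun Y hY Z hZ _ ↦ by
    obtain ⟨j, rfl⟩ := exists_eq_nth_of_isCyclicFlat hY
    obtain ⟨k, rfl⟩ := exists_eq_nth_of_isCyclicFlat hZ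
    exact (le_total j k).imp (fun h ↦ C.nth_mono h) (fun h ↦ C.nth_mono h)⟩

/-- A flat of rank `j` consists of some `Fₖ` with `k ≤ j` and of `j - k` further elements. -/
lemma exists_nth_subset_of_isFlat {G : Set (Fin n)} (hG : (chainMatroid C).IsFlat G)
    (hj : rk (chainMatroid C) G = j) :
    ∃ k ≤ j, C.nth k ⊆ G ∧ G.ncard = (C.nth k).ncard + (j - k) := by
  obtain ⟨I, hI⟩ := (chainMatroid C).exists_isBasis G (subset_univ _)
  have hIj : I.ncard = j := by rw [← hj, rk, hI.eRk_eq_encard, ← ncard_def]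
  obtain ⟨k, -, hk, hk'⟩ := ChainIndep.exists_tight hI.indep
  have hcl : (chainMatroid C).closure I = G := by rw [hI.closure_eq_closure, hG.closure]
  have hkG : C.nth k ⊆ G := by
    have hbas := chainMatroid_isBasis (ChainIndep.mono hI.indep inter_subset_left)
      (inter_subset_right (s := I) (t := C.nth k)) hk.ge
    rw [← hcl]
    exact hbas.subset_closure.trans ((chainMatroid C).closure_subset_closure inter_subset_left)
  have hunion : G = C.nth k ∪ (I \ C.nth k) := by
    rw [union_sdiff_self]
    refine Subset.antisymm (fun e he ↦ ?_) (union_subset hkG hI.subset)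
    by_contra hne
    rw [mem_union, not_or] at hne
    have hins : (chainMatroid C).Indep (insert e I) := ChainIndep.insert hI.indep hk' hne.1
    exact ((hI.indep.mem_closure_iff_of_notMem hne.2).1 (hcl ▸ he)).not_indep hins
  have h1 := ncard_inter_add_ncard_sdiff_eq_ncard I (C.nth k)
  refine ⟨k, by omega, hkG, ?_⟩
  rw [hunion, ncard_union_eq disjoint_sdiff_right]
  omega

/-! ### Triangularity -/

lemma rk_of_isFlatChain_chainMatroid (h : IsFlatChain (chainMatroid C) D) (hj : j ≤ r) :
    rk (chainMatroid C) (D.nth j) = j :=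
  LoopfreeMatroid.rk_nth (M := (chainNested C).1) h hj

lemma ncard_nth_le_of_isFlatChain (h : IsFlatChain (chainMatroid C) D) (hj : j ≤ r) :
    (D.nth j).ncard ≤ (C.nth j).ncard := by
  obtain ⟨k, hk, -, hcard⟩ := exists_nth_subset_of_isFlat (h j)
    (rk_of_isFlatChain_chainMatroid h hj)
  exact hcard.trans_le (C.ncard_nth_add_le hk hj)

/-- Among the flats of a given rank `j`, the one of largest size is unique if it is reached in a
step with more than one element. -/
lemma nth_eq_of_isFlatChain (h : IsFlatChain (chainMatroid C) D) (hj : j + 1 ≤ r)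
    (hbig : (C.nth j).ncard + 2 ≤ (C.nth (j + 1)).ncard)
    (hcard : (D.nth (j + 1)).ncard = (C.nth (j + 1)).ncard) : C.nth (j + 1) = D.nth (j + 1) := by
  obtain ⟨k, hk, hsub, hcard'⟩ := exists_nth_subset_of_isFlat (h (j + 1))
    (rk_of_isFlatChain_chainMatroid h hj)
  rcases hk.eq_or_lt with rfl | hk
  · exact eq_of_subset_of_ncard_le hsub hcard.le
  · have := C.ncard_nth_add_le (Nat.lt_succ_iff.1 hk) (by omega)
    omega

/-- If a canonical chain has a singleton step and the smaller element `b` has not been reached, then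
`b` is still missing after the next step with more than one element. -/
lemma IsCanonical.exists_big_step (hD : IsCanonical D) (hi : i + 1 ≤ r) {b b' : Fin n}
    (hb' : D.nth (i + 1) = insert b' (D.nth i)) (hb : b ∉ D.nth i) (hlt : b < b') :
    ∃ l, i + 1 ≤ l ∧ l + 1 ≤ r ∧ (D.nth l).ncard + 2 ≤ (D.nth (l + 1)).ncard ∧
      b ∉ D.nth (l + 1) := by
  by_contra! hcon
  have key : ∀ k, i ≤ k → k + 1 ≤ r →
      b ∉ D.nth (k + 1) ∧ ∃ c, D.nth (k + 1) = insert c (D.nth k) ∧ b < c := by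
    intro k hk
    induction k, hk using Nat.le_induction with
    | base =>
      intro _
      refine ⟨?_, b', hb', hlt⟩
      rw [hb']
      rintro (rfl | h)
      exacts [hlt.false, hb h]
    | succ k hk ih =>
      intro hkr
      obtain ⟨hbk, c, hc, hbc⟩ := ih (by omega)
      have hgt : ∀ a ∈ D.nth (k + 1 + 1), a ∉ D.nth (k + 1) → b < a := fun a ha ha' ↦
        hbc.trans (hD k hkr c hc a ha ha')
      have hbk' : b ∉ D.nth (k + 1 + 1) := fun h ↦ (hgt b h hbk).false
      refine ⟨hbk', ?_⟩
      obtain ⟨d, hd, hins⟩ := D.exists_eq_insert hkr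
        fun hbig ↦ hbk' (hcon (k + 1) (by omega) hkr hbig)
      exact ⟨d, hins, hgt d (hins ▸ mem_insert d _) hd⟩
  obtain ⟨s, rfl⟩ : ∃ s, r = s + 1 := ⟨r - 1, by omega⟩
  have := (key s (by omega) le_rfl).1
  rw [D.nth_of_le le_rfl] at this
  exact this trivial

lemma IsCanonical.eq_of_ncard_eq_of_big_step (hC : IsCanonical C) (hD : IsCanonical D)
    (hcard : ∀ j ≤ r, (C.nth j).ncard = (D.nth j).ncard)
    (hbig : ∀ j, j + 1 ≤ r → (C.nth j).ncard + 2 ≤ (C.nth (j + 1)).ncard →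
      C.nth (j + 1) = D.nth (j + 1)) : C = D := by
  refine ext_nth fun i hi ↦ ?_
  induction i with
  | zero => rw [C.nth_zero, D.nth_zero]
  | succ i ih =>
    have ih := ih (by omega)
    by_cases hb : (C.nth i).ncard + 2 ≤ (C.nth (i + 1)).ncard
    · exact hbig i hi hb
    obtain ⟨b, hbC, hCi⟩ := C.exists_eq_insert hi hb
    obtain ⟨b', hbD, hDi⟩ := D.exists_eq_insert hi
      (by rwa [← hcard i (by omega), ← hcard (i + 1) hi])
    rcases lt_trichotomy b b' with hlt | rfl | hlt
    · obtain ⟨l, hl, hlr, hlb, hlm⟩ := hD.exists_big_step hi hDi (ih ▸ hbC) hlt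
      rw [← hcard l (by omega), ← hcard (l + 1) hlr] at hlb
      rw [← hbig l hlr hlb] at hlm
      exact absurd (C.nth_mono (by omega) (hCi ▸ mem_insert b _)) hlm
    · rw [hCi, hDi, ih]
    · obtain ⟨l, hl, hlr, hlb, hlm⟩ := hC.exists_big_step hi hCi (ih ▸ hbD) hlt
      rw [hbig l hlr hlb] at hlm
      exact absurd (D.nth_mono (by omega) (hDi ▸ mem_insert b' _)) hlm

/-- The sum of the cardinalities of the members of a chain. -/
noncomputable def chainSize (C : SetChain r n) : ℕ :=
  ∑ j ∈ Finset.range (r + 1), (C.nth j).ncard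

/-- The matrix of the values of the vectors of chain matroids on canonical chains is unitriangular
with respect to `chainSize`. -/
lemma eq_or_chainSize_lt (hC : IsCanonical C) (hD : IsCanonical D)
    (h : IsFlatChain (chainMatroid C) D) : C = D ∨ chainSize D < chainSize C := by
  have hle : ∀ j ∈ Finset.range (r + 1), (D.nth j).ncard ≤ (C.nth j).ncard := fun j hj ↦
    ncard_nth_le_of_isFlatChain h (Nat.lt_succ_iff.1 (Finset.mem_range.1 hj))
  rcases (Finset.sum_le_sum hle).lt_or_eq with hlt | heq
  · exact Or.inr hlt
  · have hcard : ∀ j ≤ r, (D.nth j).ncard = (C.nth j).ncard := fun j hj ↦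
      (Finset.sum_eq_sum_iff_of_le hle).1 heq j (Finset.mem_range.2 (Nat.lt_succ_iff.2 hj))
    exact Or.inl (hC.eq_of_ncard_eq_of_big_step hD (fun j hj ↦ (hcard j hj).symm)
      fun j hj hb ↦ nth_eq_of_isFlatChain h hj hb (hcard _ hj))

lemma eq_of_chainMatroid_eq (hC : IsCanonical C) (hD : IsCanonical D)
    (h : chainMatroid C = chainMatroid D) : C = D := by
  rcases eq_or_chainSize_lt hC hD (h ▸ isFlatChain_chainMatroid D) with heq | hlt
  · exact heq
  rcases eq_or_chainSize_lt hD hC (h ▸ isFlatChain_chainMatroid C) with heq | hlt'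
  · exact heq.symm
  · omega

end chainMatroid

/-! ### Every nested matroid is the matroid of a canonical chain -/

/-- A flat comparable to all cyclic flats of a nested matroid is covered by such a flat. -/
lemma exists_covering_flat (N : LoopfreeNestedMatroid r n) {G : Set (Fin n)}
    (hG : N.1.1.IsFlat G) (hcomp : ∀ Z, IsCyclicFlat N.1.1 Z → Z ⊆ G ∨ G ⊆ Z)
    (hr : rk N.1.1 G < r) :
    ∃ G', N.1.1.IsFlat G' ∧ (∀ Z, IsCyclicFlat N.1.1 Z → Z ⊆ G' ∨ G' ⊆ Z) ∧ G ⊂ G' ∧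
      rk N.1.1 G' = rk N.1.1 G + 1 := by
  -- `T` is the least cyclic flat above `G`, or the ground set if there is none.
  obtain ⟨T, hT, hGT, hTZ⟩ : ∃ T, N.1.1.IsFlat T ∧ G ⊂ T ∧
      ∀ Z, IsCyclicFlat N.1.1 Z → G ⊂ Z → T ⊆ Z := by
    by_cases hex : ∃ Z, IsCyclicFlat N.1.1 Z ∧ G ⊂ Z
    · obtain ⟨T, hT⟩ := (toFinite {Z | IsCyclicFlat N.1.1 Z ∧ G ⊂ Z}).exists_minimal hex
      refine ⟨T, hT.prop.1.1, hT.prop.2, fun Z hZ hGZ ↦ ?_⟩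
      rcases N.2.total hT.prop.1 hZ with h | h
      exacts [h, hT.le_of_le ⟨hZ, hGZ⟩ h]
    · refine ⟨univ, N.1.isFlat_univ, ssubset_univ_iff.2 ?_,
        fun Z hZ hGZ ↦ absurd ⟨Z, hZ, hGZ⟩ hex⟩
      rintro rfl
      exact hr.ne N.1.rk_univ
  obtain ⟨a, haT, haG⟩ := exists_of_ssubset hGT
  have hsub := N.1.1.subset_closure (insert a G) (N.1.subset_ground _)
  have hclT : N.1.1.closure (insert a G) ⊆ T := by
    rw [← hT.closure]
    exact N.1.1.closure_subset_closure (insert_subset haT hGT.subset)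
  refine ⟨N.1.1.closure (insert a G), N.1.1.isFlat_closure _, fun Z hZ ↦ ?_, ?_, ?_⟩
  · rcases hcomp Z hZ with h | h
    · exact Or.inl (h.trans ((subset_insert a G).trans hsub))
    · rcases h.eq_or_ssubset with rfl | h
      · exact Or.inl ((subset_insert a G).trans hsub)
      · exact Or.inr (hclT.trans (hTZ Z hZ h))
  · exact ssubset_of_subset_of_ne ((subset_insert a G).trans hsub)
      fun he ↦ haG (he ▸ hsub (mem_insert a G))
  · rw [rk_closure, rk_insert (N.1.subset_ground univ trivial) (by rwa [hG.closure])]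

/-- The chain `C` is a chain of flats of `M` and passes through all cyclic flats of `M`. -/
def PassesCyclic (M : Matroid (Fin n)) (C : SetChain r n) : Prop :=
  IsFlatChain M C ∧ ∀ Z, IsCyclicFlat M Z → ∃ k, Z = C.nth k

lemma exists_passesCyclic (N : LoopfreeNestedMatroid r n) :
    ∃ C : SetChain r n, PassesCyclic N.1.1 C := by
  have hstep : ∀ G : Set (Fin n), ∃ G', N.1.1.IsFlat G →
      (∀ Z, IsCyclicFlat N.1.1 Z → Z ⊆ G ∨ G ⊆ Z) → rk N.1.1 G < r →
      N.1.1.IsFlat G' ∧ (∀ Z, IsCyclicFlat N.1.1 Z → Z ⊆ G' ∨ G' ⊆ Z) ∧ G ⊂ G' ∧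
        rk N.1.1 G' = rk N.1.1 G + 1 := fun G ↦ by
    by_cases h : N.1.1.IsFlat G ∧ (∀ Z, IsCyclicFlat N.1.1 Z → Z ⊆ G ∨ G ⊆ Z) ∧ rk N.1.1 G < r
    · obtain ⟨G', hG'⟩ := exists_covering_flat N h.1 h.2.1 h.2.2
      exact ⟨G', fun _ _ _ ↦ hG'⟩
    · exact ⟨G, fun h1 h2 h3 ↦ absurd ⟨h1, h2, h3⟩ h⟩
  choose g hg using hstep
  let f : ℕ → Set (Fin n) := fun i ↦ g^[i] ∅
  have hfs : ∀ i, f (i + 1) = g (f i) := fun i ↦ Function.iterate_succ_apply' g i ∅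
  have hf : ∀ i ≤ r, N.1.1.IsFlat (f i) ∧
      (∀ Z, IsCyclicFlat N.1.1 Z → Z ⊆ f i ∨ f i ⊆ Z) ∧ rk N.1.1 (f i) = i := by
    intro i hi
    induction i with
    | zero => exact ⟨N.1.isFlat_empty, fun Z _ ↦ Or.inr (empty_subset Z), by simp [f, rk]⟩
    | succ i ih =>
      obtain ⟨h1, h2, h3⟩ := ih (by omega)
      obtain ⟨h4, h5, -, h6⟩ := hg (f i) h1 h2 (by omega)
      rw [hfs]
      exact ⟨h4, h5, by omega⟩
  obtain ⟨C, hC⟩ := exists_of_nat f rfl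
    ((hf r le_rfl).1.eq_of_rk_le (N.1.subset_ground _) (subset_univ _)
      (by rw [N.1.rk_univ, (hf r le_rfl).2.2])) fun i hi ↦ by
    obtain ⟨h1, h2, h3⟩ := hf i hi.le
    rw [hfs]
    exact (hg (f i) h1 h2 (by omega)).2.2.1
  refine ⟨C, fun i ↦ ?_, fun Z hZ ↦ ⟨rk N.1.1 Z, ?_⟩⟩
  · rw [← C.nth_min, hC _ (min_le_right i r)]
    exact (hf _ (min_le_right i r)).1
  · have hZr : rk N.1.1 Z ≤ r := (rk_mono N.1.1 (subset_univ Z)).trans_eq N.1.rk_univ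
    obtain ⟨h1, h2, h3⟩ := hf _ hZr
    rw [hC _ hZr]
    rcases h2 Z hZ with h | h
    · exact hZ.1.eq_of_rk_le (N.1.subset_ground _) h h3.le
    · exact (h1.eq_of_rk_le (N.1.subset_ground _) h h3.ge).symm

/-- Among the chains of flats through all cyclic flats, one of maximal weight is canonical. A
singleton step does not end in a cyclic flat, so it can be exchanged. -/
lemma exists_canonical_passesCyclic (N : LoopfreeNestedMatroid r n) :
    ∃ C : SetChain r n, IsCanonical C ∧ PassesCyclic N.1.1 C := by
  classical
  obtain ⟨C₀, hC₀⟩ := exists_passesCyclic N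
  obtain ⟨C, hC, hmax⟩ := Finset.exists_max_image {C : SetChain r n | PassesCyclic N.1.1 C}
    chainWeight ⟨C₀, by simpa using hC₀⟩
  simp only [Finset.mem_filter, Finset.mem_univ, true_and] at hC hmax
  refine ⟨C, ?_, hC⟩
  by_contra hcan
  obtain ⟨i, hi, a, b, hb, ha, ha', hab⟩ := exists_of_not_isCanonical hcan
  obtain ⟨D, ⟨⟨hD, haD⟩, hfl⟩, -⟩ := N.1.existsUnique_agreeOff hC.1 hi ha
    (fun h ↦ ha' (C.nth_mono (Nat.le_succ i) h))
  have hbi : b ∉ C.nth i := fun hbi ↦ by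
    rw [insert_eq_of_mem hbi] at hb
    exact (C.nth_ssubset (lt_add_one i) (by omega)).ne hb.symm
  refine (hmax D ⟨hfl, fun Z hZ ↦ ?_⟩).not_gt
    (chainWeight_lt hi hD hb ha' hab (fun h ↦ ha' (h ▸ haD)) (Or.inl haD))
  obtain ⟨k, rfl⟩ := hC.2 Z hZ
  refine ⟨k, (hD k ?_).symm⟩
  rintro rfl
  exact hZ.ne_insert (hC.1 i) hbi hb

lemma chainMatroid_eq_of_passesCyclic {M : LoopfreeMatroid r n} {C : SetChain r n}
    (h : PassesCyclic M.1 C) : chainMatroid C = M.1 := by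
  refine Matroid.ext_indep M.2.1.symm fun I _ ↦ ⟨fun hI ↦ ?_, fun hI j ↦ ?_⟩
  · by_contra hIM
    obtain ⟨K, hKI, hK⟩ := (show M.1.Dep I from ⟨hIM, M.subset_ground I⟩).exists_isCircuit_subset
    obtain ⟨k, hk⟩ := h.2 _ (isCyclicFlat_closure hK)
    rw [← C.nth_min] at hk
    have hrk : rk M.1 (M.1.closure K) = min k r := by
      rw [hk, LoopfreeMatroid.rk_nth h.1 (min_le_right k r)]
    obtain ⟨x, hx⟩ := hK.nonempty
    rw [← hK.closure_sdiff_singleton_eq x, rk_closure, rk_indep (hK.sdiff_singleton_indep hx),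
      ncard_sdiff_singleton_of_mem hx] at hrk
    have hpos : 0 < K.ncard := (ncard_pos).2 hK.nonempty
    have hle : K.ncard ≤ min k r := ChainIndep.ncard_le_of_subset (ChainIndep.mono hI hKI)
      (hk ▸ M.1.subset_closure K hK.subset_ground)
    omega
  · have h1 : (I ∩ C.nth j).ncard ≤ rk M.1 (C.nth (min j r)) := by
      rw [C.nth_min]
      exact ncard_le_rk (hI.subset inter_subset_left) inter_subset_right
    rw [LoopfreeMatroid.rk_nth h.1 (min_le_right j r)] at h1
    exact h1.trans (min_le_left j r)

/-- Canonical chains correspond bijectively to loopfree nested matroids of rank `r`. -/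
noncomputable def canonicalEquiv (r n : ℕ) :
    {C : SetChain r n // IsCanonical C} ≃ LoopfreeNestedMatroid r n :=
  Equiv.ofBijective (fun C ↦ chainNested C.1) ⟨fun C D h ↦ Subtype.ext <|
      eq_of_chainMatroid_eq C.2 D.2 (congrArg (fun N : LoopfreeNestedMatroid r n ↦ N.1.1) h),
    fun N ↦ by
      obtain ⟨C, hC, hCN⟩ := exists_canonical_passesCyclic N
      exact ⟨⟨C, hC⟩, Subtype.ext (Subtype.ext (chainMatroid_eq_of_passesCyclic hCN))⟩⟩

/-! ### The basis -/

/-- Vectors on which an injective linear map into `ℤ^ι` takes unitriangular values are linearly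
independent and generate. -/
lemma linearIndependent_and_span_of_unitriangular {ι V : Type*} [Fintype ι] [AddCommGroup V]
    (ev : V →ₗ[ℤ] ι → ℤ) (hev : Function.Injective ev) (v : ι → V) (f : ι → ℕ)
    (h1 : ∀ i, ev (v i) i = 1) (h2 : ∀ i j, ev (v i) j ≠ 0 → i = j ∨ f j < f i) :
    LinearIndependent ℤ v ∧ ⊤ ≤ Submodule.span ℤ (range v) := by
  classical
  constructor
  · rw [Fintype.linearIndependent_iff]
    intro c hc
    by_contra! hne
    obtain ⟨i, hi, hmax⟩ := Finset.exists_max_image {i | c i ≠ 0} f (by simpa [Finset.Nonempty])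
    simp only [Finset.mem_filter, Finset.mem_univ, true_and] at hi hmax
    have h0 := congrFun (congrArg ev hc) i
    simp only [map_sum, map_smul, map_zero, Finset.sum_apply, Pi.smul_apply, Pi.zero_apply] at h0
    rw [Finset.sum_eq_single i, h1] at h0
    · simp_all
    · intro k _ hki
      by_contra hk
      rcases h2 k i (right_ne_zero_of_mul hk) with h | h
      · exact hki h
      · exact (hmax k (left_ne_zero_of_mul hk)).not_gt h
    · simp
  · have hsingle : ∀ m j, f j = m →
        Pi.single j (1 : ℤ) ∈ (Submodule.span ℤ (range v)).map ev := by
      intro m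
      induction m using Nat.strong_induction_on with
      | _ m ih =>
        rintro j rfl
        have hsum : ev (v j) = ∑ k, ev (v j) k • Pi.single k (1 : ℤ) :=
          pi_eq_sum_univ' _
        rw [← Finset.add_sum_erase _ _ (Finset.mem_univ j), h1, one_smul] at hsum
        rw [← sub_eq_iff_eq_add.2 hsum]
        refine Submodule.sub_mem _ (Submodule.mem_map_of_mem (Submodule.subset_span ⟨j, rfl⟩))
          (Submodule.sum_mem _ fun k hk ↦ ?_)
        by_cases hjk : ev (v j) k = 0
        · simp [hjk]
        · rcases h2 j k hjk with h | h
          · exact absurd h.symm (Finset.ne_of_mem_erase hk)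
          · exact Submodule.smul_mem _ _ (ih (f k) h k rfl)
    intro x _
    have hx : ev x ∈ (Submodule.span ℤ (range v)).map ev := by
      rw [pi_eq_sum_univ' (ev x)]
      exact Submodule.sum_mem _ fun k _ ↦ Submodule.smul_mem _ _ (hsingle _ k rfl)
    obtain ⟨y, hy, hyx⟩ := hx
    exact hev hyx ▸ hy

lemma phi_mem_balanced (x : LoopfreeMatroid r n →₀ ℤ) : Phi r n x ∈ balanced r n := by
  rw [Phi, Finsupp.linearCombination_apply]
  exact Submodule.sum_mem _ fun M _ ↦
    Submodule.smul_mem _ _ (indicatorVector_mem_balanced M)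

/-- The evaluation of the elements of the matroid module on canonical chains. -/
noncomputable def evalCanonical (r n : ℕ) :
    MatroidModule r n →ₗ[ℤ] {C : SetChain r n // IsCanonical C} → ℤ :=
  LinearMap.funLeft ℤ ℤ Subtype.val ∘ₗ (LinearMap.ker (Phi r n)).liftQ (Phi r n) le_rfl

lemma evalCanonical_matroidClass (M : LoopfreeMatroid r n)
    (C : {C : SetChain r n // IsCanonical C}) :
    evalCanonical r n (matroidClass M) C = indicatorVector M C.1 := by
  change Phi r n (Finsupp.single M 1) C.1 = _
  simp [Phi]

lemma evalCanonical_injective (r n : ℕ) : Function.Injective (evalCanonical r n) := by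
  rw [injective_iff_map_eq_zero]
  intro x hx
  obtain ⟨y, rfl⟩ := Submodule.Quotient.mk_surjective _ x
  rw [Submodule.Quotient.mk_eq_zero, LinearMap.mem_ker]
  exact eq_zero_of_balanced (phi_mem_balanced y) fun C hC ↦ congrFun hx ⟨C, hC⟩

lemma exists_basis_matroidClass (r n : ℕ) :
    ∃ b : Module.Basis (LoopfreeNestedMatroid r n) ℤ (MatroidModule r n),
      ∀ N : LoopfreeNestedMatroid r n, b N = matroidClass N.1 := by
  classical
  have : Fintype {C : SetChain r n // IsCanonical C} := Fintype.ofFinite _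
  obtain ⟨hli, hsp⟩ := linearIndependent_and_span_of_unitriangular (evalCanonical r n)
    (evalCanonical_injective r n) (fun C ↦ matroidClass (canonicalEquiv r n C).1)
    (fun C ↦ chainSize C.1)
    (fun C ↦ by
      rw [evalCanonical_matroidClass, indicatorVector_apply, if_pos]
      exact isFlatChain_chainMatroid C.1)
    (fun C D h ↦ by
      rw [evalCanonical_matroidClass, indicatorVector_apply, ne_eq, ite_eq_right_iff,
        Classical.not_imp] at h
      exact (eq_or_chainSize_lt C.2 D.2 h.1).imp_left Subtype.ext)
  exact ⟨(Module.Basis.mk hli hsp).reindex (canonicalEquiv r n), fun N ↦ by simp⟩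

end MatroidRing

theorem mainTheorem1 (r n : ℕ) (hr : 1 ≤ r) (hrn : r ≤ n) :
    (∃ b : Module.Basis (MatroidRing.LoopfreeNestedMatroid r n) ℤ (MatroidRing.MatroidModule r n),
      ∀ N : MatroidRing.LoopfreeNestedMatroid r n, b N = MatroidRing.matroidClass N.1) ∧
    (∀ M : MatroidRing.LoopfreeMatroid r n,
      ∃! c : MatroidRing.LoopfreeNestedMatroid r n →₀ ℤ,
        MatroidRing.matroidClass M = c.sum fun N a => a • MatroidRing.matroidClass N.1) := by
  obtain ⟨b, hb⟩ := MatroidRing.exists_basis_matroidClass r n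
  refine ⟨⟨b, hb⟩, fun M ↦ ?_⟩
  simp only [← hb, ← Finsupp.linearCombination_apply]
  refine ⟨b.repr (MatroidRing.matroidClass M), (b.linearCombination_repr _).symm, fun c hc ↦ ?_⟩
  rw [hc, b.repr_linearCombination]
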